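/- Let $K$ be a differential field of differential functions $f(x,u,u_1,u_2,\dots)$, where $u_i=\partial^i u/\partial x^i$ and $u_0=u$: a field of characteristic $0$ containing $x$ and all $u_i$, with commuting derivations $\partial/\partial x$, $\partial/\partial u_i$ acting on $x$ and the $u_j$ in the usual way, such that each $f\in K$ satisfies $\partial f/\partial u_i\neq 0$ for finitely many $i$ only (for example the field of rational functions in $x,u,u_1,u_2,\dots$). Put $$D_x=\frac{\partial}{\partial x}+\sum_{i\ge0}u_{i+1}\frac{\partial}{\partial u_i},\qquad F=u^2(1+u_2),\qquad D_t=\sum_{i\ge 0}D_x^i(F)\frac{\partial}{\partial u_i},\qquad D_F=\sum_{i\ge0}\frac{\partial F}{\partial u_i}D_x^i .$$ A function $Q\in K$ is a generalized symmetry of the equation $u_t=F$, that is of $u_t=u^2(1+u_{xx})$, if $(D_t-D_F)Q=0$. The function $Q$ is of order $n$ if $\partial Q/\partial u_n\ne0$ and $\partial Q/\partial u_m=0$ for all $m>n$. Consider the operator $$\mathcal P=u\,D_x+\frac x2+u^2(1+u_2)\,D_x^{-1}\cdot\frac1{u^2}.$$ It is a formal series in $D_x$ over $K$; formal series $\sum_{j\le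 m}r_jD_x^j$ are multiplied by $aD_x^j\cdot bD_x^k=\sum_{i\ge0}\binom ji a\,D_x^i(b)\,D_x^{j+k-i}$. For $Q,Q'\in K$ write $Q'=\mathcal P Q$ if $Q'=u D_xQ+\frac x2 Q+u^2(1+u_2)h$ for some $h\in K$ with $D_xh=Q/u^2$ (so $\mathcal PQ$, when it exists, is determined up to the choice of $h$). Put $$C_4=u^2(1+u_2),\qquad C_3=\tfrac12u^2\bigl(6u_1(1+u_2)+2uu_3+3x(1+u_2)\bigr).$$ Then: 1. The Fréchet derivative $D_\Delta=D_t-D_F$ of the equation is $D_t-u^2D_x^2-2u(1+u_2)$, and $D_\Delta\cdot\mathcal P=\mathcal P\cdot D_\Delta$ as operators, where $D_t\cdot B=D_t(B)+B\cdot D_t$ for a formal series $B$ and $D_t(B)$ is taken coefficientwise. Equivalently, $\mathcal P$ is a formal recursion operator: $D_t(\mathcal P)-[D_F,\mathcal P]=0$. 2. $\mathcal P$ is a recursion operator with root $C_4$: if $Q_1=C_4,\ Q_2,\dots,Q_n$ is any finite sequence in $K$ with $Q_{j+1}=\mathcal PQ_j$, then $Q_n$ is a generalized symmetry of the equation, and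 there is $Q_{n+1}\in K$ with $Q_{n+1}=\mathcal PQ_n$. In particular there is an infinite sequence of generalized symmetries $Q_1=C_4$, $Q_{j+1}=\mathcal PQ_j$. 3. These symmetries are of strictly increasing order: in every such sequence $Q_j$ is of order $j+1$. 4. $\mathcal PC_4=C_3$, where $C_4$ is of order $2$ and $C_3$ is of order $3$. -/

import Mathlib

noncomputable section

/-- A differential field of differential functions `f(x, u, u₁, u₂, …)`: a field `K` containing the
coordinates `x` and `uᵢ = ∂ⁱu/∂xⁱ`, with the partial derivatives `∂/∂x` and `∂/∂uᵢ`, each element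
depending on finitely many of the `uᵢ` only. -/
class JetField (K : Type*) [Field K] where
  /-- the independent variable -/
  x : K
  /-- the jet coordinates, `u 0 = u` -/
  u : ℕ → K
  /-- `∂/∂x` -/
  dx : Derivation ℤ K K
  /-- `∂/∂uᵢ` -/
  du : ℕ → Derivation ℤ K K
  dx_x : dx x = 1
  dx_u : ∀ i, dx (u i) = 0
  du_x : ∀ i, du i x = 0
  du_u : ∀ i j, du i (u j) = if i = j then 1 else 0
  dx_du_comm : ∀ i f, dx (du i f) = du i (dx f)
  du_du_comm : ∀ i j f, du i (du j f) = du j (du i f)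
  finite_du : ∀ f, {i | du i f ≠ 0}.Finite

namespace JetField

/-! ### The field of rational functions in `x, u, u₁, u₂, …` is such a field -/

section Rational

/-- Polynomials in `x` (the variable `none`) and `uᵢ` (the variables `some i`). -/
abbrev JetPoly : Type := MvPolynomial (Option ℕ) ℝ

variable (L : Type*) [Field L] [Algebra JetPoly L]

/-- The homomorphism `p ↦ p + ε ∂p/∂xₛ`. -/
def ratDual (s : Option ℕ) : JetPoly →+* TrivSqZeroExt L L where
  toFun p := (algebraMap JetPoly L p, algebraMap JetPoly L (MvPolynomial.pderiv s p))
  map_one' := TrivSqZeroExt.ext (map_one _) <| by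
    change algebraMap JetPoly L (MvPolynomial.pderiv s 1) = 0
    rw [Derivation.map_one_eq_zero, map_zero]
  map_zero' := TrivSqZeroExt.ext (map_zero _) <| by
    change algebraMap JetPoly L (MvPolynomial.pderiv s 0) = 0
    rw [map_zero, map_zero]
  map_add' p q := TrivSqZeroExt.ext (map_add _ p q) <| by
    change algebraMap JetPoly L (MvPolynomial.pderiv s (p + q)) =
      algebraMap JetPoly L (MvPolynomial.pderiv s p) +
        algebraMap JetPoly L (MvPolynomial.pderiv s q)
    rw [map_add, map_add]
  map_mul' p q := TrivSqZeroExt.ext (map_mul _ p q) <| by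
    change algebraMap JetPoly L (MvPolynomial.pderiv s (p * q)) =
      algebraMap JetPoly L p * algebraMap JetPoly L (MvPolynomial.pderiv s q) +
        algebraMap JetPoly L (MvPolynomial.pderiv s p) * algebraMap JetPoly L q
    rw [Derivation.leibniz, smul_eq_mul, smul_eq_mul, map_add, map_mul, map_mul]
    ring

variable [IsFractionRing JetPoly L]

theorem ratDual_isUnit (s : Option ℕ) (p : nonZeroDivisors JetPoly) : IsUnit (ratDual L s p) := by
  rw [TrivSqZeroExt.isUnit_iff_isUnit_fst]
  have h : algebraMap JetPoly L p ≠ 0 :=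
    IsFractionRing.to_map_ne_zero_of_mem_nonZeroDivisors p.2
  exact h.isUnit

/-- Its extension to rational functions. -/
def ratLift (s : Option ℕ) : L →+* TrivSqZeroExt L L :=
  IsLocalization.lift (M := nonZeroDivisors JetPoly) (ratDual_isUnit L s)

theorem ratLift_algebraMap (s : Option ℕ) (p : JetPoly) :
    ratLift L s (algebraMap JetPoly L p) = ratDual L s p :=
  IsLocalization.lift_eq _ _

theorem ratLift_fst (s : Option ℕ) (f : L) : (ratLift L s f).fst = f := by
  have h : (TrivSqZeroExt.fstHom L L L : _ →+* L).comp (ratLift L s) = RingHom.id L := by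
    apply IsLocalization.ringHom_ext (nonZeroDivisors JetPoly)
    refine RingHom.ext fun p => ?_
    change (ratLift L s (algebraMap JetPoly L p)).fst = algebraMap JetPoly L p
    rw [ratLift_algebraMap]
    rfl
  exact congrArg (fun g => g f) h

/-- The partial derivatives of rational functions. -/
def ratPderiv (s : Option ℕ) : Derivation ℤ L L :=
  Derivation.mk' (AddMonoidHom.mk' (fun f => (ratLift L s f).snd) (by simp)).toIntLinearMap
    fun a b => by simp [TrivSqZeroExt.snd_mul, ratLift_fst, mul_comm]

theorem ratPderiv_algebraMap (s : Option ℕ) (p : JetPoly) :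
    ratPderiv L s (algebraMap JetPoly L p) =
      algebraMap JetPoly L (MvPolynomial.pderiv s p) := by
  change (ratLift L s (algebraMap JetPoly L p)).snd = _
  rw [ratLift_algebraMap]
  rfl

theorem ratDeriv_ext (d e : Derivation ℤ L L)
    (h : ∀ p, d (algebraMap JetPoly L p) = e (algebraMap JetPoly L p)) (f : L) :
    d f = e f := by
  obtain ⟨p, q, hq, rfl⟩ := IsFractionRing.div_surjective (A := JetPoly) f
  rw [Derivation.leibniz_div, Derivation.leibniz_div, h, h]

theorem ratPderiv_comm (s t : Option ℕ) (f : L) :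
    ratPderiv L s (ratPderiv L t f) = ratPderiv L t (ratPderiv L s f) := by
  have := ratDeriv_ext L ⁅ratPderiv L s, ratPderiv L t⁆ 0 (fun p => by
    have h : ⁅MvPolynomial.pderiv (R := ℝ) s, MvPolynomial.pderiv (R := ℝ) t⁆ = 0 := by
      apply MvPolynomial.derivation_ext
      intro i
      by_cases h1 : s = i <;> by_cases h2 : t = i <;>
        simp [Derivation.commutator_apply, MvPolynomial.pderiv_X, h1, h2]
    have h' := congrArg (fun d => d p) h
    simp only [Derivation.commutator_apply, Derivation.zero_apply] at h'
    simp only [Derivation.commutator_apply, ratPderiv_algebraMap, ← map_sub, h', map_zero,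
      Derivation.zero_apply]) f
  rw [Derivation.commutator_apply, Derivation.zero_apply, sub_eq_zero] at this
  exact this

/-- The field of rational functions in `x, u, u₁, u₂, …`. -/
abbrev ratJetField : JetField L where
  x := algebraMap JetPoly L (MvPolynomial.X none)
  u i := algebraMap JetPoly L (MvPolynomial.X (some i))
  dx := ratPderiv L none
  du i := ratPderiv L (some i)
  dx_x := by simp [ratPderiv_algebraMap]
  dx_u i := by simp [ratPderiv_algebraMap, MvPolynomial.pderiv_X]
  du_x i := by simp [ratPderiv_algebraMap, MvPolynomial.pderiv_X]
  du_u i j := by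
    by_cases h : i = j
    · subst h; simp [ratPderiv_algebraMap]
    · rw [ratPderiv_algebraMap, MvPolynomial.pderiv_X_of_ne (by simpa using Ne.symm h)]
      simp [h]
  dx_du_comm _ _ := ratPderiv_comm _ _ _ _
  du_du_comm _ _ _ := ratPderiv_comm _ _ _ _
  finite_du f := by
    obtain ⟨p, q, hq, rfl⟩ := IsFractionRing.div_surjective (A := JetPoly) f
    refine (((p.vars ∪ q.vars).finite_toSet).preimage
      (Option.some_injective ℕ).injOn).subset fun i hi => ?_
    by_contra hc
    simp only [Finset.coe_union, Set.mem_preimage, Set.mem_union, Finset.mem_coe, not_or] at hc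
    apply hi
    rw [Derivation.leibniz_div, ratPderiv_algebraMap, ratPderiv_algebraMap,
      MvPolynomial.pderiv_eq_zero_of_notMem_vars hc.1,
      MvPolynomial.pderiv_eq_zero_of_notMem_vars hc.2]
    simp

instance : JetField (FractionRing JetPoly) := ratJetField _

end Rational

variable {K : Type*} [Field K] [JetField K]

/-! ### Total derivatives, prolongations, Fréchet derivatives, order -/

/-- The total derivative `D_x = ∂/∂x + ∑ᵢ uᵢ₊₁ ∂/∂uᵢ`. -/
def Dx (f : K) : K := dx f + ∑ᶠ i : ℕ, u (i + 1) * du i f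

/-- The prolonged evolutionary vector field `P^Q = ∑ᵢ D_xⁱ(Q) ∂/∂uᵢ`. On functions of
`x, u, u₁, …` the operator `P^F` is the total derivative `D_t` along the solutions of `u_t = F`. -/
def prolong (Q f : K) : K := ∑ᶠ i : ℕ, Dx^[i] Q * du i f

/-- The Fréchet derivative `D_H = ∑ᵢ ∂H/∂uᵢ D_xⁱ`, acting on functions. -/
def frechetApply (H v : K) : K := ∑ᶠ i : ℕ, du i H * Dx^[i] v

/-- `Q` is (the characteristic of) a generalized symmetry of `u_t = F`: `(D_t - D_F) Q = 0`. -/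
def IsSymmetry (F Q : K) : Prop := prolong F Q - frechetApply F Q = 0

/-- `f` is of order `n`: it depends on `uₙ`, but not on `uₘ` for `m > n`. -/
def HasOrder (f : K) (n : ℕ) : Prop := du n f ≠ 0 ∧ ∀ m, n < m → du m f = 0

theorem Dx_zero : Dx (0 : K) = 0 := by simp [Dx]

theorem prolong_zero (Q : K) : prolong Q (0 : K) = 0 := by simp [prolong]

theorem iterate_Dx_zero (i : ℕ) : Dx^[i] (0 : K) = 0 :=
  Function.iterate_fixed Dx_zero i

/-! ### Formal pseudo-differential operators -/

/-- The coefficient families `(rⱼ)` that vanish for all large `j`. -/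
def boundedAbove (K : Type*) [Field K] : AddSubgroup (ℤ → K) where
  carrier := {r | ∃ m : ℤ, ∀ j, m < j → r j = 0}
  zero_mem' := ⟨0, fun _ _ => rfl⟩
  add_mem' := by
    rintro r s ⟨m, hm⟩ ⟨n, hn⟩
    refine ⟨max m n, fun j hj => ?_⟩
    simp [hm j (lt_of_le_of_lt (le_max_left _ _) hj), hn j (lt_of_le_of_lt (le_max_right _ _) hj)]
  neg_mem' := by
    rintro r ⟨m, hm⟩
    exact ⟨m, fun j hj => by simp [hm j hj]⟩

/-- The formal series `∑_{j ≤ m} rⱼ D_xʲ`. -/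
def PsiDO (K : Type*) [Field K] : Type _ := boundedAbove K

namespace PsiDO

instance : AddCommGroup (PsiDO K) := inferInstanceAs (AddCommGroup (boundedAbove K))

/-- The coefficient of `D_xʲ`. -/
def coeff (S : PsiDO K) (j : ℤ) : K := S.1 j

/-- The operator `f D_xʲ`. -/
def single (j : ℤ) (f : K) : PsiDO K :=
  ⟨fun k => if k = j then f else 0, j, fun k hk => by simp [hk.ne']⟩

/-- The composition of formal series, determined by
`a D_xʲ ∘ b D_xᵏ = ∑_{i ≥ 0} binom(j, i) a D_xⁱ(b) D_x^{j+k-i}`, `j, k ∈ ℤ`.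
For each coefficient only finitely many terms are nonzero (`finite_support_mul`). -/
def mulCoeff (A B : PsiDO K) (n : ℤ) : K :=
  ∑ᶠ p : ℤ × ℕ, (Ring.choose p.1 p.2 : ℤ) • (A.coeff p.1 * Dx^[p.2] (B.coeff (n - p.1 + p.2)))

theorem finite_support_mul (A B : PsiDO K) (n : ℤ) : (Function.support fun p : ℤ × ℕ =>
    (Ring.choose p.1 p.2 : ℤ) •
      (A.coeff p.1 * Dx^[p.2] (B.coeff (n - p.1 + p.2)))).Finite := by
  obtain ⟨a, ha⟩ := A.2
  obtain ⟨b, hb⟩ := B.2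
  refine ((Set.finite_Icc (n - b) a).prod (Set.finite_Iic (b - n + a).toNat)).subset ?_
  rintro ⟨j, i⟩ hp
  have h1 : j ≤ a := by
    by_contra hc
    exact hp (by simp [coeff, ha j (not_le.mp hc)])
  have h2 : n - j + i ≤ b := by
    by_contra hc
    exact hp (by simp [coeff, hb _ (not_le.mp hc), iterate_Dx_zero])
  simp only [Set.mem_prod, Set.mem_Icc, Set.mem_Iic]
  omega

instance : Mul (PsiDO K) where
  mul A B := ⟨mulCoeff A B, by
    obtain ⟨a, ha⟩ := A.2
    obtain ⟨b, hb⟩ := B.2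
    refine ⟨a + b, fun n hn => ?_⟩
    rw [mulCoeff, ← finsum_zero (α := ℤ × ℕ)]
    refine finsum_congr fun p => ?_
    rcases lt_or_ge a p.1 with h | h
    · simp [coeff, ha _ h]
    · have : b < n - p.1 + p.2 := by omega
      simp [coeff, hb _ this, iterate_Dx_zero]⟩

/-- The Fréchet derivative `D_H = ∑ᵢ ∂H/∂uᵢ D_xⁱ` as a formal series. -/
def frechet (H : K) : PsiDO K :=
  ⟨fun j => if 0 ≤ j then du j.toNat H else 0, by
    obtain ⟨m, hm⟩ := (finite_du H).bddAbove
    refine ⟨m, fun j hj => ?_⟩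
    change (if 0 ≤ j then du j.toNat H else 0) = 0
    rw [if_pos (by omega)]
    by_contra hc
    have := hm hc
    omega⟩

/-- `P^Q` applied to a formal series coefficient by coefficient. -/
def prolong (Q : K) (S : PsiDO K) : PsiDO K :=
  ⟨fun j => JetField.prolong Q (S.coeff j), by
    obtain ⟨m, hm⟩ := S.2
    exact ⟨m, fun j hj => by simp [coeff, hm j hj, prolong_zero]⟩⟩

/-- `S` is a formal recursion operator of `u_t = F`: `P^F(S) - [D_F, S] = 0`. -/
def IsFormalRecursionOperator (F : K) (S : PsiDO K) : Prop :=
  prolong F S - (frechet F * S - S * frechet F) = 0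

end PsiDO

/-- Polynomials `∑ₗ Aₗ D_tˡ` in `D_t` with formal series in `D_x` as coefficients, on the solutions
of `u_t = F`. -/
def EvolOp (_F : K) : Type _ := ℕ →₀ PsiDO K

namespace EvolOp

variable {F : K}

instance : AddCommGroup (EvolOp F) := inferInstanceAs (AddCommGroup (ℕ →₀ PsiDO K))

/-- The operator `A D_tˡ`. -/
def single (F : K) (l : ℕ) (A : PsiDO K) : EvolOp F := Finsupp.single l A

/-- The composition of operators, determined by `D_t ∘ B = D_t(B) + B ∘ D_t`, that is by
`A D_tˡ ∘ B D_tᵏ = ∑_{p ≤ l} binom(l, p) A D_tᵖ(B) D_t^{l+k-p}`, where `D_t = P^F`. -/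
instance : Mul (EvolOp F) where
  mul A B := Finsupp.sum A fun l a => Finsupp.sum B fun k b =>
    ∑ p ∈ Finset.range (l + 1),
      single F (l + k - p) (l.choose p • (a * (PsiDO.prolong F)^[p] b))

/-- `D_t`. -/
def Dt (F : K) : EvolOp F := single F 1 (PsiDO.single 0 1)

/-- A formal series in `D_x` as an operator. -/
def ofPsiDO (F : K) (S : PsiDO K) : EvolOp F := single F 0 S

/-- The Fréchet derivative `D_Δ = D_t - D_F` of the equation `Δ = u_t - F = 0`. -/
def linearization (F : K) : EvolOp F := Dt F - ofPsiDO F (PsiDO.frechet F)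

end EvolOp

/-! ### Recursion operators with a nonlocal term -/

variable (K) in
/-- The operator `c₁ D_x + c₀ + a D_x⁻¹ · b`. -/
structure NonlocalOp where
  c₁ : K
  c₀ : K
  a : K
  b : K

namespace NonlocalOp

/-- The operator as a formal series in `D_x`. -/
def toPsiDO (R : NonlocalOp K) : PsiDO K :=
  PsiDO.single 1 R.c₁ + PsiDO.single 0 R.c₀
    + PsiDO.single 0 R.a * PsiDO.single (-1) 1 * PsiDO.single 0 R.b

/-- `Q' = R Q`, where `D_x⁻¹ (b Q)` may be any differential function `h` with `D_x h = b Q`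
(in particular there has to be one). -/
def Applies (R : NonlocalOp K) (Q Q' : K) : Prop :=
  ∃ h : K, Dx h = R.b * Q ∧ Q' = R.c₁ * Dx Q + R.c₀ * Q + R.a * h

/-- `Q` is an `n`-th iterate `Rⁿ Q₁`. -/
inductive IsIterate (R : NonlocalOp K) (Q₁ : K) : ℕ → K → Prop
  | root : IsIterate R Q₁ 0 Q₁
  | step {n : ℕ} {Q Q' : K} : IsIterate R Q₁ n Q → R.Applies Q Q' → IsIterate R Q₁ (n + 1) Q'

/-- `R` is a recursion operator of `u_t = F` with root `Q₁`: starting from `Q₁`, the operator can be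
applied again and again, and everything that it produces is a generalized symmetry of `u_t = F`. -/
def IsRecursionOperator (F : K) (R : NonlocalOp K) (Q₁ : K) : Prop :=
  ∀ n Q, R.IsIterate Q₁ n Q → IsSymmetry F Q ∧ ∃ Q', R.Applies Q Q'

end NonlocalOp

variable (K)

/-- The right-hand side `F = u² (1 + u₂)` of the equation. -/
def rhs : K := u 0 ^ 2 * (1 + u 2)

/-- The operator `P = u D_x + x/2 + u² (1 + u₂) D_x⁻¹ · (1/u²)`. -/
def recOp : NonlocalOp K where
  c₁ := u 0
  c₀ := x / 2
  a := u 0 ^ 2 * (1 + u 2)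
  b := 1 / u 0 ^ 2

/-- `C₃ = ½ u² (6 u₁ (1 + u₂) + 2 u u₃ + 3 x (1 + u₂))`. -/
def C₃ : K :=
  1 / 2 * u 0 ^ 2 * (6 * u 1 * (1 + u 2) + 2 * u 0 * u 3 + 3 * x * (1 + u 2))

/-- `C₄ = u² (1 + u₂)`. -/
def C₄ : K := u 0 ^ 2 * (1 + u 2)

end JetField

end

noncomputable section

namespace JetField

variable {K : Type*} [Field K] [JetField K]

/-! ### Vector fields on jet space -/

/-! The nonlocal term is tamed by potentials. If `D_t B = u² D_x² B`, then `Q = u² D_x² B` is a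
symmetry, because `D_t(u²) = 2u·F` supplies exactly the zeroth-order term of `D_F`. For such `Q` the
integrand `Q/u²` is `D_x(D_x B)`, so `D_x⁻¹(Q/u²)` is `D_x B + c` with `D_x c = 0`. Up to this `c`,
`P` intertwines with a local operator: `P ∘ u² D_x² = u² D_x² ∘ (u D_x + x/2)`, and `u D_x + x/2`
preserves solutions of `D_t B = u² D_x² B`. The constant `c` merely adds `c (u + x²/2)` to the new
potential, `u + x²/2` being the potential of `C₄`. Each step raises the order of `B` by one and `u²
D_x²` raises it by two; hence every iterate is a symmetry of the expected order to which `P` applies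
again (`HasPotential.step`).

The operator identity is separate. Put `X = D_x⁻¹·u⁻²`. Left multiplication by `D_x` is injective on
formal series and associates with products, so `D_x X = u⁻²` characterizes `X` and gives `X D_F =
D_x - D_t(X)` (`invDxMul_mul_frechet_rhs`). What remains has only multiplications and nonnegative
powers of `D_x` on the left, and is compared coefficient by coefficient. General associativity is
never required. -/

theorem finite_support_mul_du (w : ℕ → K) (f : K) :
    (Function.support fun i => w i * du i f).Finite :=
  (finite_du f).subset fun i hi h => hi (by simp [h])

/-- The vector field `∑ᵢ wᵢ ∂/∂uᵢ`. -/
def vectorField (w : ℕ → K) : Derivation ℤ K K :=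
  Derivation.mk' (AddMonoidHom.mk' (fun f => ∑ᶠ i : ℕ, w i * du i f) fun f g => by
    rw [← finsum_add_distrib (finite_support_mul_du w f) (finite_support_mul_du w g)]
    exact finsum_congr fun i => by rw [map_add, mul_add]).toIntLinearMap fun f g => by
    change ∑ᶠ i : ℕ, w i * du i (f * g) =
      f * (∑ᶠ i : ℕ, w i * du i g) + g * ∑ᶠ i : ℕ, w i * du i f
    rw [mul_finsum' _ _ (finite_support_mul_du w g), mul_finsum' _ _ (finite_support_mul_du w f),
      ← finsum_add_distrib
        ((finite_support_mul_du w g).subset fun i hi h => hi (by simp [h]))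
        ((finite_support_mul_du w f).subset fun i hi h => hi (by simp [h]))]
    exact finsum_congr fun i => by
      rw [Derivation.leibniz, smul_eq_mul, smul_eq_mul]; ring

theorem vectorField_apply (w : ℕ → K) (f : K) :
    vectorField w f = ∑ᶠ i : ℕ, w i * du i f := rfl

theorem vectorField_u (w : ℕ → K) (j : ℕ) : vectorField w (u j) = w j := by
  rw [vectorField_apply, finsum_eq_single _ j fun i hi => by simp [du_u, hi]]
  simp [du_u]

theorem vectorField_x (w : ℕ → K) : vectorField w x = 0 := by
  simp [vectorField_apply, du_x]

theorem derivation_vectorField (d : Derivation ℤ K K) (w : ℕ → K) (f : K) :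
    d (vectorField w f) = vectorField (fun i => d (w i)) f + ∑ᶠ i : ℕ, w i * d (du i f) := by
  rw [vectorField_apply, vectorField_apply, ← finsum_add_distrib (finite_support_mul_du _ f)
    ((finite_du f).subset fun i hi h => hi (by simp [h]))]
  rw [show d (∑ᶠ i, w i * du i f) = ∑ᶠ i, d (w i * du i f) from
    AddMonoidHom.map_finsum (d : K →+ K) (finite_support_mul_du w f)]
  exact finsum_congr fun i => by rw [Derivation.leibniz, smul_eq_mul, smul_eq_mul]; ring

variable (K) in
/-- The total derivative as a derivation. -/
def totalDerivation : Derivation ℤ K K := dx + vectorField fun i => u (i + 1)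

theorem totalDerivation_apply (f : K) : totalDerivation K f = Dx f := rfl

/-- The prolonged evolutionary vector field as a derivation. -/
def prolongDerivation (Q : K) : Derivation ℤ K K := vectorField fun i => Dx^[i] Q

theorem prolongDerivation_apply (Q f : K) : prolongDerivation Q f = prolong Q f := rfl

/-! ### Calculus rules for `D_x` and for evolutionary vector fields -/

theorem Dx_add (f g : K) : Dx (f + g) = Dx f + Dx g := map_add (totalDerivation K) f g

theorem Dx_sub (f g : K) : Dx (f - g) = Dx f - Dx g := map_sub (totalDerivation K) f g

theorem Dx_neg (f : K) : Dx (-f) = -Dx f := map_neg (totalDerivation K) f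

theorem Dx_mul (f g : K) : Dx (f * g) = f * Dx g + Dx f * g := by
  rw [mul_comm (Dx f)]; exact (totalDerivation K).leibniz f g

theorem Dx_zsmul (n : ℤ) (f : K) : Dx (n • f) = n • Dx f := map_zsmul (totalDerivation K) n f

theorem Dx_one : Dx (1 : K) = 0 := (totalDerivation K).map_one_eq_zero

theorem Dx_x : Dx (x : K) = 1 := by
  change dx x + vectorField _ x = 1
  rw [dx_x, vectorField_x, add_zero]

theorem Dx_u (i : ℕ) : Dx (u i : K) = u (i + 1) := by
  change dx (u i) + vectorField _ (u i) = _
  rw [dx_u, vectorField_u, zero_add]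

theorem Dx_two : Dx (2 : K) = 0 := (totalDerivation K).map_natCast 2

theorem Dx_inv (f : K) : Dx f⁻¹ = -Dx f / f ^ 2 := by
  refine ((totalDerivation K).leibniz_inv f).trans ?_
  rw [smul_eq_mul, totalDerivation_apply, div_eq_mul_inv, inv_pow]
  ring

theorem Dx_pow (f : K) (n : ℕ) : Dx (f ^ n) = n * f ^ (n - 1) * Dx f := by
  refine ((totalDerivation K).leibniz_pow f n).trans ?_
  simp [totalDerivation_apply, mul_assoc]

theorem Dx_div (f g : K) : Dx (f / g) = Dx f / g - f * Dx g / g ^ 2 := by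
  rw [div_eq_mul_inv, Dx_mul, Dx_inv]; ring

section prolong

variable (Q : K)

theorem prolong_add (f g : K) : prolong Q (f + g) = prolong Q f + prolong Q g :=
  map_add (prolongDerivation Q) f g

theorem prolong_sub (f g : K) : prolong Q (f - g) = prolong Q f - prolong Q g :=
  map_sub (prolongDerivation Q) f g

theorem prolong_mul (f g : K) : prolong Q (f * g) = f * prolong Q g + prolong Q f * g := by
  rw [mul_comm (prolong Q f)]; exact (prolongDerivation Q).leibniz f g

theorem prolong_one : prolong Q (1 : K) = 0 := (prolongDerivation Q).map_one_eq_zero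

theorem prolong_x : prolong Q (x : K) = 0 := vectorField_x _

theorem prolong_u (i : ℕ) : prolong Q (u i : K) = Dx^[i] Q := vectorField_u _ i

theorem prolong_two : prolong Q (2 : K) = 0 := (prolongDerivation Q).map_natCast 2

theorem prolong_inv (f : K) : prolong Q f⁻¹ = -prolong Q f / f ^ 2 := by
  refine ((prolongDerivation Q).leibniz_inv f).trans ?_
  rw [smul_eq_mul, prolongDerivation_apply, div_eq_mul_inv, inv_pow]
  ring

theorem prolong_pow (f : K) (n : ℕ) : prolong Q (f ^ n) = n * f ^ (n - 1) * prolong Q f := by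
  refine ((prolongDerivation Q).leibniz_pow f n).trans ?_
  simp [prolongDerivation_apply, mul_assoc]

theorem prolong_div (f g : K) :
    prolong Q (f / g) = prolong Q f / g - f * prolong Q g / g ^ 2 := by
  rw [div_eq_mul_inv, prolong_mul, prolong_inv]; ring

end prolong

theorem du_two (k : ℕ) : du k (2 : K) = 0 := (du k : Derivation ℤ K K).map_natCast 2

theorem du_mul (k : ℕ) (f g : K) : du k (f * g) = f * du k g + du k f * g := by
  rw [mul_comm (du k f)]; exact (du k : Derivation ℤ K K).leibniz f g

theorem u_zero_ne_zero : (u 0 : K) ≠ 0 := fun h => by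
  have h1 : du 0 (u 0 : K) = 1 := by simp [du_u]
  rw [h, map_zero] at h1
  exact zero_ne_one h1

/-! ### Commutators -/

/-- The partial derivatives commute with each other, so the commutator comes only from
differentiating the coefficients `uᵢ₊₁` of `D_x`; it is `∂/∂uₖ₋₁`, or zero for `k = 0`. -/
theorem du_Dx (k : ℕ) (f : K) :
    du k (Dx f) = Dx (du k f) + ∑ᶠ i : ℕ, (if k = i + 1 then 1 else 0) * du i f := by
  change du k (dx f + vectorField _ f) = _
  rw [map_add, derivation_vectorField, ← dx_du_comm, Dx, vectorField_apply, add_assoc,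
    add_comm (∑ᶠ i, _ * du i f)]
  congr 2
  · exact finsum_congr fun i => by rw [du_du_comm]
  · exact finsum_congr fun i => by rw [du_u]

theorem du_zero_Dx (f : K) : du 0 (Dx f) = Dx (du 0 f) := by
  simp [du_Dx]

theorem du_succ_Dx (k : ℕ) (f : K) : du (k + 1) (Dx f) = Dx (du (k + 1) f) + du k f := by
  rw [du_Dx, finsum_eq_single _ k fun i hi => by simp [hi.symm]]
  simp

/-- The coefficients `D_xⁱ Q` are chosen for this: the derivative of the `i`-th one is the next one,
which matches the shift in `[∂/∂uᵢ₊₁, D_x] = ∂/∂uᵢ`. -/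
theorem prolong_Dx (Q f : K) : prolong Q (Dx f) = Dx (prolong Q f) := by
  obtain ⟨N, hN⟩ := (finite_du f).bddAbove
  have hf : ∀ i, N < i → du i f = 0 := fun i hi => by
    by_contra h
    exact absurd (hN h) (by omega)
  have hDf : ∀ i, N + 1 < i → du i (Dx f) = 0 := fun i hi => by
    obtain ⟨j, rfl⟩ : ∃ j, i = j + 1 := ⟨i - 1, by omega⟩
    rw [du_succ_Dx, hf _ (by omega), hf _ (by omega), Dx_zero, add_zero]
  -- One more term than for `f`, since `D_x` raises the order by one.
  have h1 : prolong Q (Dx f) = ∑ i ∈ Finset.range (N + 2), Dx^[i] Q * du i (Dx f) :=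
    finsum_eq_sum_of_support_subset _ fun i hi => by
      by_contra h
      exact hi (by simp [hDf i (by simp at h; omega)])
  have h2 : prolong Q f = ∑ i ∈ Finset.range (N + 1), Dx^[i] Q * du i f :=
    finsum_eq_sum_of_support_subset _ fun i hi => by
      by_contra h
      exact hi (by simp [hf i (by simp at h; omega)])
  rw [h1, h2, ← totalDerivation_apply (∑ i ∈ _, _), map_sum, Finset.sum_range_succ']
  simp only [totalDerivation_apply, Dx_mul, du_succ_Dx, du_zero_Dx, mul_add,
    Finset.sum_add_distrib, ← Function.iterate_succ_apply' Dx]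
  have h3 := Finset.sum_range_succ' (fun i => Dx^[i] Q * Dx (du i f)) (N + 1)
  rw [Finset.sum_range_succ, hf (N + 1) (by omega), Dx_zero, mul_zero, add_zero] at h3
  rw [h3]
  ring

/-! ### Order and the kernel of `D_x` -/

theorem HasOrder.Dx {f : K} {n : ℕ} (hf : HasOrder f n) : HasOrder (Dx f) (n + 1) := by
  refine ⟨?_, fun m hm => ?_⟩
  · rw [du_succ_Dx, hf.2 _ (Nat.lt_succ_self n), Dx_zero, zero_add]
    exact hf.1
  · obtain ⟨j, rfl⟩ : ∃ j, m = j + 1 := ⟨m - 1, by omega⟩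
    rw [du_succ_Dx, hf.2 _ (by omega), hf.2 _ (by omega), Dx_zero, add_zero]

theorem HasOrder.add {f g : K} {n : ℕ} (hf : HasOrder f n) (hg : ∀ m, n ≤ m → du m g = 0) :
    HasOrder (f + g) n :=
  ⟨by rw [map_add, hg n le_rfl, add_zero]; exact hf.1,
    fun m hm => by rw [map_add, hf.2 m hm, hg m hm.le, add_zero]⟩

theorem HasOrder.mul {f g : K} {n : ℕ} (hf : HasOrder f n) (hg0 : g ≠ 0)
    (hg : ∀ m, n ≤ m → du m g = 0) : HasOrder (g * f) n :=
  ⟨by rw [du_mul, hg n le_rfl, zero_mul, add_zero]; exact mul_ne_zero hg0 hf.1,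
    fun m hm => by rw [du_mul, hf.2 m hm, hg m hm.le, mul_zero, zero_mul, add_zero]⟩

theorem exists_hasOrder {f : K} {i : ℕ} (hf : du i f ≠ 0) : ∃ n, HasOrder f n := by
  obtain ⟨n, hn, hmax⟩ := (finite_du f).exists_maximal ⟨i, hf⟩
  refine ⟨n, hn, fun m hm => ?_⟩
  by_contra h
  exact absurd (hmax h hm.le) (by omega)

/-- If `c` depended on some `uᵢ` it would have an order `n`, and `D_x c` would have order `n + 1`.
Integration constants are therefore also killed by `D_t`. -/
theorem du_eq_zero_of_Dx_eq_zero {c : K} (hc : Dx c = 0) (i : ℕ) : du i c = 0 := by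
  by_contra h
  obtain ⟨n, hn⟩ := exists_hasOrder h
  exact hn.Dx.1 (by rw [hc, map_zero])

theorem prolong_eq_zero_of_Dx_eq_zero (Q : K) {c : K} (hc : Dx c = 0) : prolong Q c = 0 := by
  simp [prolong, du_eq_zero_of_Dx_eq_zero hc]

/-! ### The equation `u_t = u² (1 + u₂)` -/

theorem du_rhs (j : ℕ) : du j (rhs K) =
    (if j = 2 then u 0 ^ 2 else 0) + if j = 0 then 2 * u 0 * (1 + u 2) else 0 := by
  rw [rhs, pow_two, du_mul, du_mul, map_add, Derivation.map_one_eq_zero, du_u, du_u]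
  split_ifs <;> ring

theorem frechetApply_rhs (v : K) :
    frechetApply (rhs K) v = u 0 ^ 2 * Dx (Dx v) + 2 * u 0 * (1 + u 2) * v := by
  rw [frechetApply, finsum_eq_sum_of_support_subset (s := Finset.range 3) _ fun i hi => by
    by_contra h
    simp only [Finset.coe_range, Set.mem_Iio, not_lt] at h
    exact hi (by simp [du_rhs, show i ≠ 2 by omega, show i ≠ 0 by omega])]
  simp [Finset.sum_range_succ, du_rhs]
  ring

/-- The operator `B ↦ u D_x B + (x/2) B`. -/
def potentialStep (B : K) : K := u 0 * Dx B + x / 2 * B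

/-- `Q = u² D_x² B` for a solution `B` of order `n` of `D_t B = u² D_x² B`. -/
def HasPotential (Q B : K) (n : ℕ) : Prop :=
  Q = u 0 ^ 2 * Dx (Dx B) ∧ prolong (rhs K) B = u 0 ^ 2 * Dx (Dx B) ∧ HasOrder B n

variable (K) in
/-- The potential `u + x²/2` of `C₄`. -/
def rootPotential : K := u 0 + x ^ 2 / 2

/-- `D_t Q = 2u F D_x² B + u² D_x² Q`, and `2u F D_x² B = 2u (1 + u₂) Q`. -/
theorem HasPotential.isSymmetry {Q B : K} {n : ℕ} (h : HasPotential Q B n) :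
    IsSymmetry (rhs K) Q := by
  obtain ⟨rfl, hB, -⟩ := h
  rw [IsSymmetry, frechetApply_rhs, prolong_mul, prolong_Dx, prolong_Dx, hB, prolong_pow,
    prolong_u, Function.iterate_zero_apply, rhs]
  push_cast
  ring

theorem HasPotential.hasOrder {Q B : K} {n : ℕ} (h : HasPotential Q B n) :
    HasOrder Q (n + 2) := by
  obtain ⟨rfl, -, hB⟩ := h
  refine hB.Dx.Dx.mul (pow_ne_zero 2 u_zero_ne_zero) fun m hm => ?_
  rw [pow_two, du_mul, du_u, if_neg (by omega)]
  simp

/-- `D_x B` is an antiderivative of `Q/u² = D_x² B`. -/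
theorem HasPotential.applies {Q B : K} {n : ℕ} (h : HasPotential Q B n) :
    (recOp K).Applies Q (u 0 * Dx Q + x / 2 * Q + u 0 ^ 2 * (1 + u 2) * Dx B) := by
  refine ⟨Dx B, ?_, rfl⟩
  have := pow_ne_zero 2 (u_zero_ne_zero (K := K))
  rw [h.1, recOp, one_div, inv_mul_cancel_left₀ this]

/-- The factor `1 + u₂` of the nonlocal term arises here: `u₂` from differentiating `u` twice, `1`
from the two cross terms of `x/2`. It is left as `2 / 2` because the characteristic is still
arbitrary. -/
theorem Dx_Dx_potentialStep (B : K) : Dx (Dx (potentialStep B)) =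
    u 0 * Dx (Dx (Dx B)) + 2 * u 1 * Dx (Dx B) + x / 2 * Dx (Dx B) + (u 2 + 2 / 2) * Dx B := by
  simp only [potentialStep, Dx_add, Dx_mul, Dx_div, Dx_u, Dx_x, Dx_two, Dx_one, mul_zero,
    zero_div, sub_zero]
  ring

/-! ### The potential of the root and the recursion step -/

variable [CharZero K]

theorem Dx_rootPotential : Dx (rootPotential K) = u 1 + x := by
  have h2 : (2 : K) ≠ 0 := two_ne_zero
  simp only [rootPotential, Dx_add, Dx_div, Dx_pow, Dx_u, Dx_x, Dx_two]
  field_simp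
  push_cast
  ring

theorem Dx_Dx_rootPotential : Dx (Dx (rootPotential K)) = u 2 + 1 := by
  rw [Dx_rootPotential, Dx_add, Dx_u, Dx_x]

theorem hasOrder_rootPotential : HasOrder (rootPotential K) 0 := by
  have h : ∀ m, du m (rootPotential K) = if m = 0 then 1 else 0 := fun m => by
    rw [rootPotential, pow_two, map_add, du_u, div_eq_mul_inv, du_mul, du_mul, du_x,
      Derivation.leibniz_inv, du_two]
    simp
  exact ⟨by simp [h], fun m hm => by simp [h, hm.ne']⟩

theorem hasPotential_C₄ : HasPotential (C₄ K) (rootPotential K) 0 := by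
  refine ⟨by rw [Dx_Dx_rootPotential, C₄, add_comm], ?_, hasOrder_rootPotential⟩
  rw [Dx_Dx_rootPotential, rootPotential, prolong_add, prolong_u, prolong_div, prolong_pow,
    prolong_x, prolong_two, Function.iterate_zero_apply, rhs]
  ring

/-- The identity `P ∘ u² D_x² = u² D_x² ∘ (u D_x + x/2)`, with an arbitrary integration constant
`c`. Its contribution is `c C₄`, absorbed by `c` times the potential of the root. The order is
governed by `u D_x B`; the other terms have order at most `n`. -/
theorem HasPotential.step {Q B c : K} {n : ℕ} (h : HasPotential Q B n) (hc : Dx c = 0) :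
    HasPotential (u 0 * Dx Q + x / 2 * Q + u 0 ^ 2 * (1 + u 2) * (Dx B + c))
      (potentialStep B + c * rootPotential K) (n + 1) := by
  have h2 : (2 : K) ≠ 0 := two_ne_zero
  obtain ⟨rfl, hB, hn⟩ := h
  have hDD : Dx (Dx (potentialStep B + c * rootPotential K)) =
      u 0 * Dx (Dx (Dx B)) + 2 * u 1 * Dx (Dx B) + x / 2 * Dx (Dx B) + (u 2 + 1) * (Dx B + c) := by
    rw [Dx_add, Dx_mul, hc, zero_mul, add_zero, Dx_add, Dx_mul, hc, Dx_Dx_potentialStep,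
      Dx_Dx_rootPotential, div_self h2]
    ring
  refine ⟨?_, ?_, ?_⟩
  · rw [hDD, Dx_mul, Dx_pow, Dx_u]
    push_cast
    ring
  · rw [hDD, prolong_add, prolong_mul, prolong_eq_zero_of_Dx_eq_zero _ hc,
      hasPotential_C₄.2.1, Dx_Dx_rootPotential, potentialStep, prolong_add, prolong_mul,
      prolong_Dx, prolong_mul, hB, Dx_mul, Dx_pow, prolong_u, prolong_div, prolong_x,
      prolong_two, Dx_u, Function.iterate_zero_apply, rhs]
    push_cast
    ring
  · refine HasOrder.add (HasOrder.add (hn.Dx.mul u_zero_ne_zero fun m hm => ?_)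
      fun m hm => ?_) fun m hm => ?_
    · rw [du_u, if_neg (by omega)]
    · rw [div_eq_mul_inv, du_mul, du_mul, du_x, Derivation.leibniz_inv, du_two, hn.2 m (by omega)]
      simp
    · rw [du_mul, du_eq_zero_of_Dx_eq_zero hc, hasOrder_rootPotential.2 m (by omega)]
      simp

theorem HasPotential.exists_of_applies {Q Q' B : K} {n : ℕ} (h : HasPotential Q B n)
    (hQ' : (recOp K).Applies Q Q') : ∃ B', HasPotential Q' B' (n + 1) := by
  obtain ⟨k, hk, rfl⟩ := hQ'
  have h0 := pow_ne_zero 2 (u_zero_ne_zero (K := K))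
  -- Any two antiderivatives of `Q/u²` differ by a constant of `D_x`, so the arbitrary choice `k` is
  -- covered by the step with this `c`.
  have hc : Dx (k - Dx B) = 0 := by
    rw [Dx_sub, hk, h.1, recOp, one_div, inv_mul_cancel_left₀ h0, sub_self]
  have := h.step hc
  rw [add_sub_cancel] at this
  exact ⟨_, this⟩

theorem exists_hasPotential_of_isIterate {n : ℕ} {Q : K}
    (h : (recOp K).IsIterate (C₄ K) n Q) : ∃ B, HasPotential Q B n := by
  induction h with
  | root => exact ⟨_, hasPotential_C₄⟩
  | step _ hQ' ih => exact ih.elim fun B hB => hB.exists_of_applies hQ'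

theorem applies_C₄_C₃ : (recOp K).Applies (C₄ K) (C₃ K) := by
  have h2 : (2 : K) ≠ 0 := two_ne_zero
  convert (hasPotential_C₄ (K := K)).applies using 1
  rw [Dx_rootPotential, C₃, C₄]
  simp only [Dx_mul, Dx_pow, Dx_add, Dx_one, Dx_u]
  field_simp
  push_cast
  ring

end JetField

end

noncomputable section

namespace JetField

variable {K : Type*} [Field K]

/-! ### Algebra of formal series -/

namespace PsiDO

theorem ext {A B : PsiDO K} (h : ∀ n, A.coeff n = B.coeff n) : A = B := Subtype.ext (funext h)

theorem coeff_zero (n : ℤ) : (0 : PsiDO K).coeff n = 0 := rfl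

theorem coeff_add (A B : PsiDO K) (n : ℤ) : (A + B).coeff n = A.coeff n + B.coeff n := rfl

theorem coeff_sub (A B : PsiDO K) (n : ℤ) : (A - B).coeff n = A.coeff n - B.coeff n := rfl

theorem coeff_single (j : ℤ) (f : K) (n : ℤ) :
    (single j f).coeff n = if n = j then f else 0 := rfl

/-- The bounds `j ≤ a` and `n - j + i ≤ b` confine the indices to a finite box, whatever derivatives
are applied to the coefficients. -/
theorem finite_support_of_coeff_eq_zero (A B : PsiDO K) (n : ℤ) {g : ℤ × ℕ → K}
    (hA : ∀ p, A.coeff p.1 = 0 → g p = 0) (hB : ∀ p, B.coeff (n - p.1 + p.2) = 0 → g p = 0) :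
    (Function.support g).Finite := by
  obtain ⟨a, ha⟩ := A.2
  obtain ⟨b, hb⟩ := B.2
  refine ((Set.finite_Icc (n - b) a).prod (Set.finite_Iic (b - n + a).toNat)).subset ?_
  rintro ⟨j, i⟩ hp
  have h1 : j ≤ a := by
    by_contra hc
    exact hp (hA _ (ha j (not_le.mp hc)))
  have h2 : n - j + i ≤ b := by
    by_contra hc
    exact hp (hB _ (hb _ (not_le.mp hc)))
  simp only [Set.mem_prod, Set.mem_Icc, Set.mem_Iic]
  omega

theorem finsum_prod_eq_finsum_succ {M : Type*} [AddCommMonoid M] (g : ℤ × ℕ → M)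
    (hg : ∀ j, g (j, 0) = 0) :
    ∑ᶠ p : ℤ × ℕ, g p = ∑ᶠ p : ℤ × ℕ, g (p.1, p.2 + 1) := by
  have hinj : Function.Injective fun p : ℤ × ℕ => (p.1, p.2 + 1) := fun p q h => by
    simp only [Prod.mk.injEq, Nat.add_right_cancel_iff] at h
    exact Prod.ext h.1 h.2
  rw [← finsum_mem_range (f := g) hinj, finsum_mem_def]
  refine finsum_congr fun p => ?_
  rw [Set.indicator_eq_self.mpr]
  rintro ⟨j, i⟩ hp
  rcases i with _ | i
  · exact absurd (hg j) hp
  · exact ⟨(j, i), rfl⟩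

variable [JetField K]

theorem coeff_prolong (Q : K) (S : PsiDO K) (n : ℤ) :
    (prolong Q S).coeff n = JetField.prolong Q (S.coeff n) := rfl

theorem coeff_frechet (H : K) (n : ℤ) :
    (frechet H).coeff n = if 0 ≤ n then du n.toNat H else 0 := rfl

theorem coeff_mul (A B : PsiDO K) (n : ℤ) : (A * B).coeff n =
    ∑ᶠ p : ℤ × ℕ,
      (Ring.choose p.1 p.2 : ℤ) • (A.coeff p.1 * Dx^[p.2] (B.coeff (n - p.1 + p.2))) := rfl

theorem iterate_Dx_add (i : ℕ) (f g : K) : Dx^[i] (f + g) = Dx^[i] f + Dx^[i] g :=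
  Function.Semiconj₂.iterate (f := Dx) (op := (· + ·)) Dx_add i f g

/-- The ring structure on formal series, without the associativity, which is not needed here. -/
abbrev nonUnitalNonAssocRing : NonUnitalNonAssocRing (PsiDO K) where
  left_distrib A B C := ext fun n => by
    simp only [coeff_add, coeff_mul]
    rw [← finsum_add_distrib (finite_support_mul A B n) (finite_support_mul A C n)]
    exact finsum_congr fun p => by rw [iterate_Dx_add, mul_add, smul_add]
  right_distrib A B C := ext fun n => by
    simp only [coeff_add, coeff_mul]
    rw [← finsum_add_distrib (finite_support_mul A C n) (finite_support_mul B C n)]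
    exact finsum_congr fun p => by rw [add_mul, smul_add]
  zero_mul A := ext fun n => by simp [coeff_mul, coeff_zero]
  mul_zero A := ext fun n => by simp [coeff_mul, coeff_zero, iterate_Dx_zero]

attribute [local instance] nonUnitalNonAssocRing

/-! ### Products with a multiplication or a nonnegative power of `D_x` on the left -/

theorem coeff_single_natCast_mul (m : ℕ) (f : K) (B : PsiDO K) (n : ℤ) :
    (single m f * B).coeff n =
      ∑ i ∈ Finset.range (m + 1), (m.choose i : ℤ) • (f * Dx^[i] (B.coeff (n - m + i))) := by
  rw [coeff_mul, finsum_eq_sum_of_support_subset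
    (s := (Finset.range (m + 1)).map ⟨fun i => ((m : ℤ), i), Prod.mk_right_injective _⟩)]
  · rw [Finset.sum_map]
    exact Finset.sum_congr rfl fun i _ => by
      change Ring.choose (m : ℤ) i • ((single m f).coeff m * Dx^[i] (B.coeff (n - m + i))) = _
      rw [coeff_single, if_pos rfl, Ring.choose_natCast]
  · rintro ⟨j, i⟩ hp
    rw [Function.mem_support] at hp
    have hj : j = m := by
      by_contra h
      exact hp (by simp [coeff_single, h])
    subst hj
    have hi : i < m + 1 := by
      by_contra h
      exact hp (by simp [Ring.choose_natCast, Nat.choose_eq_zero_of_lt (show m < i by omega)])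
    exact Finset.mem_coe.mpr (Finset.mem_map.mpr ⟨i, Finset.mem_range.mpr hi, rfl⟩)

theorem coeff_single_zero_mul (f : K) (B : PsiDO K) (n : ℤ) :
    (single 0 f * B).coeff n = f * B.coeff n := by
  simpa using coeff_single_natCast_mul 0 f B n

theorem coeff_single_one_mul (f : K) (B : PsiDO K) (n : ℤ) :
    (single 1 f * B).coeff n = f * (B.coeff (n - 1) + Dx (B.coeff n)) := by
  simpa [Finset.sum_range_succ, mul_add] using coeff_single_natCast_mul 1 f B n

theorem coeff_single_two_mul (f : K) (B : PsiDO K) (n : ℤ) : (single 2 f * B).coeff n =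
    f * (B.coeff (n - 2) + 2 * Dx (B.coeff (n - 1)) + Dx (Dx (B.coeff n))) := by
  have h := coeff_single_natCast_mul 2 f B n
  simp only [Finset.sum_range_succ, Finset.sum_range_zero] at h
  simp only [Nat.cast_ofNat, Nat.choose_zero_right, Nat.choose_one_right, Nat.choose_self,
    Nat.cast_one, Nat.cast_zero, add_zero, zero_add, one_smul, zsmul_eq_mul,
    Function.iterate_zero_apply, Function.iterate_succ_apply, sub_add_cancel,
    show n - 2 + 1 = n - 1 by ring] at h
  rw [h]
  push_cast
  ring

theorem single_zero_mul_mul (f : K) (A B : PsiDO K) :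
    single 0 f * A * B = single 0 f * (A * B) := ext fun n => by
  rw [coeff_single_zero_mul, coeff_mul, coeff_mul, mul_finsum' _ _ (finite_support_mul _ _ n)]
  exact finsum_congr fun p => by rw [coeff_single_zero_mul, mul_assoc, mul_smul_comm]

theorem single_zero_one_mul (B : PsiDO K) : single 0 1 * B = B :=
  ext fun n => by rw [coeff_single_zero_mul, one_mul]

theorem mul_single_zero_one (A : PsiDO K) : A * single 0 1 = A := ext fun n => by
  rw [coeff_mul, finsum_eq_single _ (n, 0)]
  · simp [coeff_single]
  · rintro ⟨j, i⟩ hp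
    rcases i with _ | i
    · have : n - j ≠ 0 := fun h => hp (by rw [sub_eq_zero.mp h])
      simp [coeff_single, this]
    · rw [coeff_single]
      split_ifs <;> simp [Function.iterate_succ_apply, Dx_one, Dx_zero, iterate_Dx_zero]

/-! ### Left multiplication by `D_x` -/

/-- Leibniz for `D_x` on the coefficients of `A * B`, combined with Pascal's rule for `binom(j + 1,
i)`. -/
theorem single_one_mul_mul (A B : PsiDO K) :
    single 1 1 * A * B = single 1 1 * (A * B) := ext fun n => by
  rw [coeff_single_one_mul, one_mul]
  have hD : Dx ((A * B).coeff n) = ∑ᶠ p : ℤ × ℕ, ((Ring.choose p.1 p.2 : ℤ) •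
      (Dx (A.coeff p.1) * Dx^[p.2] (B.coeff (n - p.1 + p.2))) + (Ring.choose p.1 p.2 : ℤ) •
      (A.coeff p.1 * Dx^[p.2 + 1] (B.coeff (n - p.1 + p.2)))) := by
    rw [coeff_mul, ← totalDerivation_apply]
    refine (AddMonoidHom.map_finsum (totalDerivation K : K →+ K)
      (finite_support_mul A B n)).trans (finsum_congr fun p => ?_)
    refine (Dx_zsmul _ _).trans ?_
    rw [Dx_mul, smul_add, add_comm, Function.iterate_succ_apply']
  have hf1 : (Function.support fun p : ℤ × ℕ => (Ring.choose p.1 p.2 : ℤ) •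
      (Dx (A.coeff p.1) * Dx^[p.2] (B.coeff (n - p.1 + p.2)))).Finite :=
    finite_support_of_coeff_eq_zero A B n (fun p h => by simp [h, Dx_zero])
      fun p h => by simp [h, iterate_Dx_zero]
  have hf2 : (Function.support fun p : ℤ × ℕ => (Ring.choose p.1 p.2 : ℤ) •
      (A.coeff p.1 * Dx^[p.2 + 1] (B.coeff (n - p.1 + p.2)))).Finite :=
    finite_support_of_coeff_eq_zero A B n (fun p h => by simp [h])
      fun p h => by simp only [h, iterate_Dx_zero, mul_zero, smul_zero]
  -- `T` collects the terms where `D_x` passes through to raise the power in `A`, reindexed by `j ↦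
  -- j - 1` through `e`; `W` those where it hits the coefficients of `B`, with `i` shifted by one.
  -- Pascal's rule splits `T` into the coefficient of `A * B` at `n - 1` and `W`.
  let T : ℤ × ℕ → K := fun p =>
    (Ring.choose (p.1 + 1) p.2 : ℤ) • (A.coeff p.1 * Dx^[p.2] (B.coeff (n - 1 - p.1 + p.2)))
  let W : ℤ × ℕ → K := fun p => if p.2 = 0 then 0 else
    (Ring.choose p.1 (p.2 - 1) : ℤ) • (A.coeff p.1 * Dx^[p.2] (B.coeff (n - 1 - p.1 + p.2)))
  let e : ℤ × ℕ ≃ ℤ × ℕ := (Equiv.subRight (1 : ℤ)).prodCongr (Equiv.refl ℕ)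
  have hT : (Function.support T).Finite :=
    finite_support_of_coeff_eq_zero A B (n - 1) (fun p h => by simp [T, h])
      fun p h => by simp only [T, h, iterate_Dx_zero, mul_zero, smul_zero]
  have hW : (Function.support W).Finite :=
    finite_support_of_coeff_eq_zero A B (n - 1) (fun p h => by simp [W, h])
      fun p h => by simp only [W, h, iterate_Dx_zero, mul_zero, smul_zero, ite_self]
  have hTe : (Function.support (T ∘ e)).Finite := by
    rw [Function.support_comp_eq_preimage]
    exact hT.preimage e.injective.injOn
  have hTW : ∑ᶠ p, T p = (A * B).coeff (n - 1) + ∑ᶠ p, W p := by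
    rw [coeff_mul, ← finsum_add_distrib (finite_support_mul A B (n - 1)) hW]
    refine finsum_congr fun ⟨j, i⟩ => ?_
    rcases i with _ | i
    · simp [T, W]
    · simp only [T, W, Nat.add_sub_cancel, Nat.succ_ne_zero, if_false, Ring.choose_succ_succ,
        add_smul]
      exact add_comm _ _
  have hW' : ∑ᶠ p, W p = ∑ᶠ p : ℤ × ℕ, (Ring.choose p.1 p.2 : ℤ) •
      (A.coeff p.1 * Dx^[p.2 + 1] (B.coeff (n - p.1 + p.2))) := by
    rw [finsum_prod_eq_finsum_succ W fun j => by simp [W]]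
    refine finsum_congr fun p => ?_
    simp only [W, Nat.add_sub_cancel, Nat.succ_ne_zero, if_false]
    rw [show n - 1 - p.1 + ((p.2 + 1 : ℕ) : ℤ) = n - p.1 + p.2 by push_cast; ring]
  rw [hD, finsum_add_distrib hf1 hf2, ← hW', add_left_comm, ← hTW, ← finsum_comp_equiv (f := T) e,
    coeff_mul]
  refine Eq.trans ?_ (finsum_add_distrib hf1 hTe)
  refine finsum_congr fun p => ?_
  simp only [coeff_single_one_mul, one_mul, T, e, Equiv.prodCongr_apply,
    Prod.map, Equiv.subRight_apply, Equiv.refl_apply, sub_add_cancel, add_mul, smul_add]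
  rw [show n - 1 - (p.1 - 1) + p.2 = n - p.1 + p.2 by ring, add_comm]

/-- If `D_x C = 0`, then `Cₙ₋₁ = -D_x(Cₙ)`; as `C` vanishes in high degrees, downward induction
kills every coefficient. -/
theorem eq_of_single_one_mul_eq {A B : PsiDO K} (h : single 1 1 * A = single 1 1 * B) :
    A = B := by
  rw [← sub_eq_zero, ← mul_sub] at h
  rw [← sub_eq_zero]
  generalize A - B = C at h
  obtain ⟨m, hm⟩ := C.2
  have hstep : ∀ n, C.coeff n = 0 → C.coeff (n - 1) = 0 := fun n hn => by
    have := congrArg (fun S => S.coeff n) h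
    simpa [coeff_single_one_mul, hn, Dx_zero, coeff_zero] using this
  have hdown : ∀ k : ℕ, C.coeff (m + 1 - k) = 0 := fun k => by
    induction k with
    | zero => exact hm _ (by simp)
    | succ k ih => rw [Nat.cast_succ, ← sub_sub]; exact hstep _ ih
  refine ext fun n => ?_
  rcases lt_or_ge m n with hn | hn
  · exact hm n hn
  · have := hdown (m + 1 - n).toNat
    rwa [Int.toNat_of_nonneg (by omega), sub_sub_cancel] at this

theorem prolong_single_one_mul (Q : K) (A : PsiDO K) :
    prolong Q (single 1 1 * A) = single 1 1 * prolong Q A := ext fun n => by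
  simp only [coeff_prolong, coeff_single_one_mul, one_mul, prolong_add, prolong_Dx]

theorem prolong_single_zero (Q : K) (f : K) :
    prolong Q (single 0 f) = single 0 (JetField.prolong Q f) := ext fun n => by
  rw [coeff_prolong, coeff_single, coeff_single]
  split_ifs
  · rfl
  · exact prolong_zero Q

/-! ### The formal recursion operator -/

/-- The formal series `D_x⁻¹ · b`. -/
def invDxMul (b : K) : PsiDO K := single (-1) 1 * single 0 b

theorem single_one_mul_invDxMul (b : K) : single 1 1 * invDxMul b = single 0 b := by
  rw [invDxMul, ← single_one_mul_mul]
  have : single 1 1 * single (-1) 1 = single 0 (1 : K) := ext fun n => by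
    simp only [coeff_single_one_mul, coeff_single, one_mul]
    split_ifs <;> first | omega | simp [Dx_one, Dx_zero]
  rw [this, single_zero_one_mul]

theorem _root_.JetField.NonlocalOp.toPsiDO_eq (R : NonlocalOp K) :
    R.toPsiDO = single 1 R.c₁ + single 0 R.c₀ + single 0 R.a * invDxMul R.b := by
  rw [NonlocalOp.toPsiDO, single_zero_mul_mul, invDxMul]

variable (K) in
theorem frechet_rhs :
    frechet (rhs K) = single 2 (u 0 ^ 2) + single 0 (2 * u 0 * (1 + u 2)) := ext fun n => by
  rw [coeff_frechet, coeff_add, coeff_single, coeff_single]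
  rcases lt_or_ge n 0 with hn | hn
  · rw [if_neg (by omega), if_neg (by omega), if_neg (by omega), add_zero]
  · lift n to ℕ using hn
    rw [if_pos (by omega), Int.toNat_natCast, du_rhs]
    norm_cast

/-- After left multiplication by `D_x` this reads `u⁻² D_F = D_x² - D_t(u⁻²)`, which holds because
`-D_t(u⁻²) = 2u⁻³F = 2(1 + u₂)/u`. -/
theorem invDxMul_mul_frechet_rhs : invDxMul (1 / u 0 ^ 2) * frechet (rhs K) =
    single 1 1 - prolong (rhs K) (invDxMul (1 / u 0 ^ 2)) := by
  have h0 := u_zero_ne_zero (K := K)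
  apply eq_of_single_one_mul_eq
  rw [← single_one_mul_mul, single_one_mul_invDxMul, mul_sub, ← prolong_single_one_mul,
    single_one_mul_invDxMul, prolong_single_zero, frechet_rhs]
  refine ext fun n => ?_
  simp only [coeff_sub, coeff_single_zero_mul, coeff_single_one_mul, coeff_add, coeff_single,
    prolong_div, prolong_pow, prolong_one, prolong_u, Function.iterate_zero_apply, rhs]
  split_ifs <;> first | omega | (simp [Dx_one, Dx_zero]; try (field_simp))

theorem isFormalRecursionOperator_recOp [CharZero K] :
    IsFormalRecursionOperator (rhs K) (recOp K).toPsiDO := by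
  have h0 := u_zero_ne_zero (K := K)
  have h2 : (2 : K) ≠ 0 := two_ne_zero
  have hX := single_one_mul_invDxMul (1 / u 0 ^ 2 : K)
  have hXF := invDxMul_mul_frechet_rhs (K := K)
  rw [IsFormalRecursionOperator, NonlocalOp.toPsiDO_eq, sub_eq_zero]
  -- This removes the only product with the nonlocal series on the left; the `D_t(X)` it introduces
  -- cancels the one in `D_t(P)`.
  simp only [recOp, add_mul, single_zero_mul_mul, hXF]
  -- From here on only `D_x X = u⁻²` matters, used as the rule `hD` for differentiating coefficients
  -- of `X`.
  generalize invDxMul (1 / u 0 ^ 2 : K) = X at hX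
  rw [frechet_rhs]
  refine ext fun n => ?_
  have hD : ∀ m, Dx (X.coeff m) = (if m = 0 then 1 / u 0 ^ 2 else 0) - X.coeff (m - 1) :=
    fun m => by
      rw [← coeff_single, ← hX, coeff_single_one_mul, one_mul, add_sub_cancel_left]
  simp only [coeff_sub, coeff_add, coeff_prolong, coeff_single_zero_mul, coeff_single_one_mul,
    coeff_single_two_mul, coeff_single, add_mul, mul_add, Dx_add, Dx_mul, hD]
  -- The local terms have degrees `0` to `3`; in all other degrees only coefficients of `X` survive.
  have hn : n = 0 ∨ n = 1 ∨ n = 2 ∨ n = 3 ∨ n ≠ 0 ∧ n ≠ 1 ∧ n ≠ 2 ∧ n ≠ 3 := by omega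
  rcases hn with rfl | rfl | rfl | rfl | ⟨hn0, hn1, hn2, hn3⟩
  on_goal 5 =>
    have hD' := hD (n - 1)
    rw [if_neg (by omega)] at hD'
    simp only [hn0, hn1, hn2, show n - 1 ≠ 0 by omega, show n - 1 ≠ 1 by omega,
      show n - 1 ≠ 2 by omega, show n - 2 ≠ 0 by omega, show n - 2 ≠ 1 by omega,
      show n - 1 - 1 = n - 2 by ring, if_false, Dx_sub, Dx_zero, hD']
  all_goals
    norm_num [Dx_zero, Dx_one, Dx_two, Dx_x, Dx_u, Dx_mul, Dx_pow, Dx_div, Dx_add, Dx_sub, Dx_neg,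
      Dx_inv, hD, prolong_add, prolong_mul, prolong_pow, prolong_u, prolong_one, prolong_two,
      prolong_x, prolong_div, rhs]
    try field_simp
    try ring

end PsiDO

/-! ### Operators in `D_x` and `D_t` -/

namespace EvolOp

variable {F : K}

theorem single_zero (l : ℕ) : single F l 0 = 0 := Finsupp.single_zero l

theorem single_sub (l : ℕ) (A B : PsiDO K) :
    single F l (A - B) = single F l A - single F l B := Finsupp.single_sub l A B

variable [JetField K]

attribute [local instance] PsiDO.nonUnitalNonAssocRing

theorem iterate_prolong_zero (Q : K) (p : ℕ) : (PsiDO.prolong Q)^[p] 0 = 0 :=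
  Function.iterate_fixed (f := PsiDO.prolong Q) (x := 0) (PsiDO.ext fun _ => prolong_zero Q) p

theorem iterate_prolong_sub (Q : K) (p : ℕ) (A B : PsiDO K) :
    (PsiDO.prolong Q)^[p] (A - B) = (PsiDO.prolong Q)^[p] A - (PsiDO.prolong Q)^[p] B :=
  Function.Semiconj₂.iterate (f := PsiDO.prolong Q) (op := (· - ·))
    (fun _ _ => PsiDO.ext fun _ => prolong_sub Q _ _) p A B

theorem mul_def (A B : EvolOp F) : A * B =
    Finsupp.sum A fun l a => Finsupp.sum B fun k b => ∑ p ∈ Finset.range (l + 1),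
      single F (l + k - p) (l.choose p • (a * (PsiDO.prolong F)^[p] b)) := rfl

theorem sub_mul (A B C : EvolOp F) : (A - B) * C = A * C - B * C := by
  simp only [mul_def]
  refine Finsupp.sum_sub_index fun l a b => ?_
  refine Eq.trans (Finsupp.sum_congr fun k _ => ?_) (Finsupp.sum_sub (f := C))
  simp only [_root_.sub_mul, smul_sub, single_sub, Finset.sum_sub_distrib]

theorem mul_sub (A B C : EvolOp F) : A * (B - C) = A * B - A * C := by
  simp only [mul_def]
  refine Eq.trans (Finsupp.sum_congr fun l _ => ?_) (Finsupp.sum_sub (f := A))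
  refine Finsupp.sum_sub_index fun k b c => ?_
  simp only [iterate_prolong_sub, _root_.mul_sub, smul_sub, single_sub, Finset.sum_sub_distrib]

theorem single_mul_single (l k : ℕ) (A B : PsiDO K) : single F l A * single F k B =
    ∑ p ∈ Finset.range (l + 1),
      single F (l + k - p) (l.choose p • (A * (PsiDO.prolong F)^[p] B)) := by
  rw [mul_def]
  refine (Finsupp.sum_single_index ?_).trans (Finsupp.sum_single_index ?_)
  · refine Finset.sum_eq_zero fun k _ => Finset.sum_eq_zero fun _ _ => ?_
    simp only [zero_mul, smul_zero, single_zero]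
  · refine Finset.sum_eq_zero fun _ _ => ?_
    simp only [iterate_prolong_zero, mul_zero, smul_zero, single_zero]

theorem Dt_mul_ofPsiDO (A : PsiDO K) :
    Dt F * ofPsiDO F A = ofPsiDO F (PsiDO.prolong F A) + single F 1 A := by
  rw [Dt, ofPsiDO, single_mul_single]
  simp [Finset.sum_range_succ, PsiDO.single_zero_one_mul, ofPsiDO, add_comm]

theorem ofPsiDO_mul_Dt (A : PsiDO K) : ofPsiDO F A * Dt F = single F 1 A := by
  rw [Dt, ofPsiDO, single_mul_single]
  simp [PsiDO.mul_single_zero_one]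

theorem ofPsiDO_mul_ofPsiDO (A B : PsiDO K) :
    ofPsiDO F A * ofPsiDO F B = ofPsiDO F (A * B) := by
  rw [ofPsiDO, ofPsiDO, single_mul_single]
  simp [ofPsiDO]

/-- A formal recursion operator commutes with the Fréchet derivative of the equation. -/
theorem linearization_mul_ofPsiDO {S : PsiDO K} (hS : PsiDO.IsFormalRecursionOperator F S) :
    linearization F * ofPsiDO F S = ofPsiDO F S * linearization F := by
  rw [linearization, sub_mul, mul_sub, Dt_mul_ofPsiDO, ofPsiDO_mul_Dt, ofPsiDO_mul_ofPsiDO,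
    ofPsiDO_mul_ofPsiDO, sub_eq_zero.mp hS]
  simp only [ofPsiDO, single_sub]
  abel

end EvolOp

end JetField

end

/-! ### The infinite sequence, and the theorem -/

noncomputable section

namespace JetField

variable {K : Type*} [Field K] [JetField K] [CharZero K]

theorem exists_recursion_sequence : ∃ Q : ℕ → K, Q 0 = C₄ K ∧
    (∀ j, (recOp K).Applies (Q j) (Q (j + 1))) ∧
      ∀ j, IsSymmetry (rhs K) (Q j) ∧ HasOrder (Q j) (j + 2) := by
  have h : ∀ n, HasPotential (u 0 ^ 2 * Dx (Dx (potentialStep^[n] (rootPotential K))))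
      (potentialStep^[n] (rootPotential K)) n := fun n => by
    induction n with
    | zero =>
      have := hasPotential_C₄ (K := K)
      rwa [this.1] at this
    | succ n ih =>
      -- All integration constants are taken to be `0`, so the potentials are the iterates of `u D_x
      -- + x/2` on `u + x²/2`.
      have := ih.step Dx_zero
      rw [zero_mul, add_zero, add_zero, ← Function.iterate_succ_apply' potentialStep] at this
      rwa [this.1] at this
  refine ⟨fun n => u 0 ^ 2 * Dx (Dx (potentialStep^[n] (rootPotential K))),
    hasPotential_C₄.1.symm, fun n => ?_, fun n => ⟨(h n).isSymmetry, (h n).hasOrder⟩⟩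
  have := ((h n).step Dx_zero).1
  rw [zero_mul, add_zero, add_zero, ← Function.iterate_succ_apply' potentialStep] at this
  have h' := (h n).applies
  rwa [this] at h'

end JetField

end

theorem mainTheorem4 (K : Type*) [Field K] [CharZero K] [JetField K] :
    -- the Fréchet derivative of the equation is `D_t - u² D_x² - 2 u (1 + u₂)`
    (JetField.EvolOp.linearization (JetField.rhs K) =
      JetField.EvolOp.Dt (JetField.rhs K) -
        JetField.EvolOp.ofPsiDO (JetField.rhs K)
          (JetField.PsiDO.single 2 (JetField.u 0 ^ 2) +
            JetField.PsiDO.single 0 (2 * JetField.u 0 * (1 + JetField.u 2)))) ∧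
    -- it commutes with `P`
    (JetField.EvolOp.linearization (JetField.rhs K) *
        JetField.EvolOp.ofPsiDO (JetField.rhs K) (JetField.recOp K).toPsiDO =
      JetField.EvolOp.ofPsiDO (JetField.rhs K) (JetField.recOp K).toPsiDO *
        JetField.EvolOp.linearization (JetField.rhs K)) ∧
    -- `P` is a formal recursion operator
    JetField.PsiDO.IsFormalRecursionOperator (JetField.rhs K) (JetField.recOp K).toPsiDO ∧
    -- `P` is a recursion operator with root `C₄ = u² (1 + u₂)`
    (JetField.recOp K).IsRecursionOperator (JetField.rhs K) (JetField.C₄ K) ∧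
    -- the symmetries generated by `P` from the root are of strictly increasing order
    (∀ n Q, (JetField.recOp K).IsIterate (JetField.C₄ K) n Q → JetField.HasOrder Q (n + 2)) ∧
    (∃ Q : ℕ → K, Q 0 = JetField.C₄ K ∧ (∀ j, (JetField.recOp K).Applies (Q j) (Q (j + 1))) ∧
      ∀ j, JetField.IsSymmetry (JetField.rhs K) (Q j) ∧ JetField.HasOrder (Q j) (j + 2)) ∧
    -- `P C₄ = C₃`, of orders 2 and 3
    (JetField.recOp K).Applies (JetField.C₄ K) (JetField.C₃ K) ∧
    JetField.HasOrder (JetField.C₄ K) 2 ∧ JetField.HasOrder (JetField.C₃ K) 3 := by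
  have hP := JetField.PsiDO.isFormalRecursionOperator_recOp (K := K)
  refine ⟨?_, JetField.EvolOp.linearization_mul_ofPsiDO hP, hP, fun n Q hQ => ?_,
    fun n Q hQ => ?_, JetField.exists_recursion_sequence, JetField.applies_C₄_C₃,
    JetField.hasPotential_C₄.hasOrder, ?_⟩
  · rw [JetField.EvolOp.linearization, JetField.PsiDO.frechet_rhs]
  · obtain ⟨B, hB⟩ := JetField.exists_hasPotential_of_isIterate hQ
    exact ⟨hB.isSymmetry, _, hB.applies⟩
  · obtain ⟨B, hB⟩ := JetField.exists_hasPotential_of_isIterate hQ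
    exact hB.hasOrder
  -- The order of `C₃` is read off from its potential of order `1`.
  · obtain ⟨B, hB⟩ := (JetField.hasPotential_C₄ (K := K)).exists_of_applies JetField.applies_C₄_C₃
    exact hB.hasOrder
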